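/- Let $\mathbb{D}=\{z\in\mathbb{C}:|z|<1\}$. There exists an absolute constant $m>0$ such that every analytic function $f:\mathbb{D}\to\mathbb{C}$ with $$e^{-m}<\left|\frac{zf'(z)}{f(z)}\right|<e^{m}\qquad\text{for all } z \text{ with } 0<|z|<1$$ is univalent (that is, injective) on $\mathbb{D}$. Moreover, $m=\pi/12$ is such a constant. (The condition is understood to include that $f(z)\neq 0$ for $0<|z|<1$.) -/

import Mathlib

/-- The condition `e^{-m} < |z f'(z) / f(z)| < e^m` on the unit disk. It is imposed at the points
`z ≠ 0` only, where the quotient needs no interpretation when `f(0) = 0`. A zero `z ≠ 0` of `f`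
violates it, since then the quotient is `0` in Lean. -/
def LogDerivInAnnulus (m : ℝ) (f : ℂ → ℂ) : Prop :=
  ∀ z : ℂ, 0 < ‖z‖ → ‖z‖ < 1 →
    Real.exp (-m) < ‖z * deriv f z / f z‖ ∧ ‖z * deriv f z / f z‖ < Real.exp m

/-- Every analytic function on the unit disk satisfying the annulus condition with the constant `m`
is univalent (injective) on the unit disk. -/
def AnnulusConditionImpliesUnivalence (m : ℝ) : Prop :=
  ∀ f : ℂ → ℂ, DifferentiableOn ℂ f (Metric.ball 0 1) → LogDerivInAnnulus m f →
    Set.InjOn f (Metric.ball 0 1)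

/-! In the coordinate `z = exp (-w)`, which maps the right half-plane onto the punctured disk, a
branch `Φ` of `-log f(exp (-w))` has derivative `z f'(z) / f(z)`, so the hypothesis says that `Φ'`
takes values in an annulus. Then `log Φ'` maps into the strip `|Re| < m`, and Schwarz–Pick gives `2
Re w |Φ''/Φ'| ≤ 8m/π`, which is less than `1` when `m < π/8`.

This is a Becker condition. After a small translation, the Ahlfors–Becker reflection extends the
function to a `C¹` map of the whole plane whose real differential `h ↦ a h + b conj h` satisfies
`|b| ≤ k|a|` with `k < 1` and `|a|` bounded below. Its inverses are uniformly bounded, so Hadamard's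
theorem makes the extension, hence `Φ`, injective. Since `Φ` commutes with translation by `2πi`,
injectivity descends to `f`. -/

/-! ### Hadamard's global injectivity theorem -/

open Set Metric Filter Topology in
/-- Near every point, a map with invertible strict derivative whose inverse has norm less than `C`
has a local section that is `C`-Lipschitz on balls of uniform radius. -/
theorem HasStrictFDerivAt.exists_uniform_section {E : Type*} [NormedAddCommGroup E]
    [NormedSpace ℝ E] [CompleteSpace E] {h : E → E} {h' : E ≃L[ℝ] E} {x : E}
    (hh : HasStrictFDerivAt h (h' : E →L[ℝ] E) x) {C : NNReal}
    (hC : ‖(h'.symm : E →L[ℝ] E)‖₊ < C) :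
    ∃ U ∈ 𝓝 x, ∃ δ > 0, ∀ x' ∈ U, ∃ g : E → E, LipschitzOnWith C g (ball (h x') δ) ∧
      g (h x') = x' ∧ ∀ y ∈ ball (h x') δ, h (g y) = y := by
  obtain ⟨s, hs, hL⟩ := hh.to_localInverse.exists_lipschitzOnWith_of_nnnorm_lt C hC
  obtain ⟨δ, hδ, hball⟩ := Metric.mem_nhds_iff.1 (inter_mem hs hh.eventually_right_inverse)
  refine ⟨_, inter_mem hh.eventually_left_inverse
    (hh.continuousAt.preimage_mem_nhds (ball_mem_nhds (h x) (half_pos hδ))), δ / 2, half_pos hδ, ?_⟩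
  rintro x' ⟨hx', hx'δ⟩
  have hsub : ball (h x') (δ / 2) ⊆ ball (h x) δ := by
    refine ball_subset_ball' ?_
    have := mem_ball.1 hx'δ
    linarith
  exact ⟨hh.localInverse h h' x, hL.mono fun y hy => (hball (hsub hy)).1, hx',
    fun y hy => (hball (hsub hy)).2⟩

-- A radius serves all subsets of a set, and the smaller of two radii serves a union, so compactness
-- turns the local radii into a single one.
open Set Metric Filter Topology in
theorem IsCompact.exists_uniform_section {E : Type*} [NormedAddCommGroup E]
    [NormedSpace ℝ E] [CompleteSpace E] {h : E → E} {h' : E → E ≃L[ℝ] E}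
    (hh : ∀ x, HasStrictFDerivAt h (h' x : E →L[ℝ] E) x) {C : NNReal}
    (hC : ∀ x, ‖((h' x).symm : E →L[ℝ] E)‖₊ < C) {K : Set E} (hK : IsCompact K) :
    ∃ δ > 0, ∀ x ∈ K, ∃ g : E → E, LipschitzOnWith C g (ball (h x) δ) ∧
      g (h x) = x ∧ ∀ y ∈ ball (h x) δ, h (g y) = y := by
  refine hK.induction_on (p := fun K => ∃ δ > 0, ∀ x ∈ K, ∃ g : E → E,
    LipschitzOnWith C g (ball (h x) δ) ∧ g (h x) = x ∧ ∀ y ∈ ball (h x) δ, h (g y) = y)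
    ⟨1, one_pos, by simp⟩ ?_ ?_ ?_
  · rintro s t hst ⟨δ, hδ, H⟩
    exact ⟨δ, hδ, fun x hx => H x (hst hx)⟩
  · rintro s t ⟨δ₁, hδ₁, H₁⟩ ⟨δ₂, hδ₂, H₂⟩
    refine ⟨min δ₁ δ₂, lt_min hδ₁ hδ₂, ?_⟩
    rintro x (hx | hx)
    · obtain ⟨g, hg, hgx, hgy⟩ := H₁ x hx
      have := ball_subset_ball (x := h x) (min_le_left δ₁ δ₂)
      exact ⟨g, hg.mono this, hgx, fun y hy => hgy y (this hy)⟩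
    · obtain ⟨g, hg, hgx, hgy⟩ := H₂ x hx
      have := ball_subset_ball (x := h x) (min_le_right δ₁ δ₂)
      exact ⟨g, hg.mono this, hgx, fun y hy => hgy y (this hy)⟩
  · intro x _
    obtain ⟨U, hU, δ, hδ, H⟩ := (hh x).exists_uniform_section (hC x)
    exact ⟨U, mem_nhdsWithin_of_mem_nhds hU, δ, hδ, H⟩

open Set Metric Filter Topology in
/-- Segments lift through a map whose derivatives are uniformly expanding. -/
theorem exists_segment_lift {E : Type*} [NormedAddCommGroup E]
    [NormedSpace ℝ E] [ProperSpace E] {h : E → E} {h' : E → E ≃L[ℝ] E}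
    (hh : ∀ x, HasStrictFDerivAt h (h' x : E →L[ℝ] E) x) {C : NNReal}
    (hC : ∀ x, ‖((h' x).symm : E →L[ℝ] E)‖₊ < C) (x₀ v : E) :
    ∃ Γ : ℝ → E, ContinuousOn Γ (Icc 0 1) ∧ Γ 0 = x₀ ∧
      ∀ t ∈ Icc (0 : ℝ) 1, h (Γ t) = h x₀ + t • v ∧ ‖Γ t - x₀‖ ≤ C * ‖v‖ * t := by
  obtain ⟨δ, hδ, H⟩ := (isCompact_closedBall x₀ (C * ‖v‖)).exists_uniform_section hh hC
  -- One step of length `η` moves the target by less than `δ`. The Lipschitz bound keeps the lift in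
  -- the compact ball, so `η` never has to shrink; the `+ 1` allows `v = 0`.
  set η := δ / (‖v‖ + 1) with hη
  have hη0 : 0 < η := by positivity
  have hηv : η * ‖v‖ < δ := by
    have : η * (‖v‖ + 1) = δ := by rw [hη]; field_simp
    nlinarith
  let P : ℝ → Prop := fun s => ∃ Γ : ℝ → E, ContinuousOn Γ (Icc 0 s) ∧ Γ 0 = x₀ ∧
      ∀ t ∈ Icc (0 : ℝ) s, h (Γ t) = h x₀ + t • v ∧ ‖Γ t - x₀‖ ≤ C * ‖v‖ * t
  have mono : ∀ s s', s ≤ s' → P s' → P s := by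
    rintro s s' hs ⟨Γ, h1, h2, h3⟩
    exact ⟨Γ, h1.mono (Icc_subset_Icc_right hs), h2, fun t ht => h3 t ⟨ht.1, ht.2.trans hs⟩⟩
  have step : ∀ s, 0 ≤ s → s ≤ 1 → P s → P (s + η) := by
    rintro s hs0 hs1 ⟨Γ, h1, h2, h3⟩
    obtain ⟨hs3, hs4⟩ := h3 s ⟨hs0, le_rfl⟩
    have hmem : Γ s ∈ closedBall x₀ (C * ‖v‖) := by
      rw [mem_closedBall_iff_norm]
      exact hs4.trans (mul_le_of_le_one_right (by positivity) hs1)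
    obtain ⟨g, hg, hgs, hgr⟩ := H _ hmem
    have hin : ∀ t ∈ Icc s (s + η), h x₀ + t • v ∈ ball (h (Γ s)) δ := by
      intro t ht
      rw [mem_ball_iff_norm, hs3, add_sub_add_left_eq_sub, ← sub_smul, norm_smul, Real.norm_eq_abs,
        abs_of_nonneg (by linarith [ht.1])]
      refine lt_of_le_of_lt ?_ hηv
      gcongr
      linarith [ht.2]
    have heq : ∀ t ≥ s, t ≤ s →  g (h x₀ + t • v) = Γ t := by
      intro t h1 h2
      obtain rfl := le_antisymm h1 h2
      rw [← hs3, hgs]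
    refine ⟨fun t => if t ≤ s then Γ t else g (h x₀ + t • v), ?_, by simp [hs0, h2], ?_⟩
    · have hu : Icc 0 (s + η) = Icc 0 s ∪ Icc s (s + η) :=
        (Icc_union_Icc_eq_Icc hs0 (by linarith)).symm
      rw [hu]
      refine ContinuousOn.union_of_isClosed ?_ ?_ isClosed_Icc isClosed_Icc
      · exact h1.congr fun t ht => if_pos ht.2
      · have : ContinuousOn (fun t : ℝ => g (h x₀ + t • v)) (Icc s (s + η)) :=
          hg.continuousOn.comp (by fun_prop) hin
        refine this.congr fun t ht => ?_
        by_cases hts : t ≤ s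
        · simp only [hts, if_true, heq t ht.1 hts]
        · simp [hts]
    · intro t ht
      by_cases hts : t ≤ s
      · simpa only [hts, if_true] using h3 t ⟨ht.1, hts⟩
      · simp only [hts, if_false]
        have ht' : t ∈ Icc s (s + η) := ⟨(not_le.1 hts).le, ht.2⟩
        refine ⟨hgr _ (hin t ht'), ?_⟩
        have h5 := hg.norm_sub_le (hin t ht') (mem_ball_self hδ)
        rw [hgs, hs3, add_sub_add_left_eq_sub, ← sub_smul, norm_smul, Real.norm_eq_abs,
          abs_of_nonneg (by linarith [ht'.1])] at h5
        calc ‖g (h x₀ + t • v) - x₀‖ ≤ ‖g (h x₀ + t • v) - Γ s‖ + ‖Γ s - x₀‖ :=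
              norm_sub_le_norm_sub_add_norm_sub _ _ _
          _ ≤ C * ((t - s) * ‖v‖) + C * ‖v‖ * s := add_le_add h5 hs4
          _ = C * ‖v‖ * t := by ring
  have all : ∀ n : ℕ, P (min (n * η) 1) := by
    intro n
    induction n with
    | zero =>
      refine ⟨fun _ => x₀, continuousOn_const, rfl, ?_⟩
      rintro t ⟨ht0, ht⟩
      obtain rfl : t = 0 := le_antisymm (by simpa using ht) ht0
      simp
    | succ n ih =>
      refine mono _ _ ?_ (step _ (by positivity) (min_le_right _ _) ih)
      rw [← min_add_add_right]
      push_cast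
      exact min_le_min (by linarith) (by linarith)
  obtain ⟨n, hn⟩ := exists_nat_ge (1 / η)
  have h1 := all n
  rwa [min_eq_right] at h1
  rwa [div_le_iff₀ hη0] at hn

open Set Metric Filter Topology unitInterval in
/-- The injectivity half of Hadamard's global inverse function theorem: a map whose derivatives
are invertible with uniformly bounded inverses is injective. -/
theorem injective_of_hasStrictFDerivAt_equiv {E : Type*} [NormedAddCommGroup E]
    [NormedSpace ℝ E] [ProperSpace E] {h : E → E} {h' : E → E ≃L[ℝ] E}
    (hh : ∀ x, HasStrictFDerivAt h (h' x : E →L[ℝ] E) x) {C : NNReal}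
    (hC : ∀ x, ‖((h' x).symm : E →L[ℝ] E)‖₊ < C) : Function.Injective h := by
  intro a b hab
  have hloc : IsLocalHomeomorph h := IsLocalHomeomorph.mk _ fun x =>
    ⟨(hh x).toOpenPartialHomeomorph h, (hh x).mem_toOpenPartialHomeomorph_source, fun _ _ => rfl⟩
  have hcont : Continuous h := hloc.continuous
  have hsep : IsSeparatedMap h := T2Space.isSeparatedMap h
  let e : I → E := fun t => a + (t : ℝ) • (b - a)
  have he : Continuous e := by fun_prop
  -- Contract the loop `h ∘ e` to `h a` along straight segments and lift each segment, starting at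
  -- `e t`.
  choose Γ hΓc hΓ0 hΓ using fun t : I => exists_segment_lift hh hC (e t) (h a - h (e t))
  let f : C(I × I, E) := ⟨fun p => h (e p.2) + (p.1 : ℝ) • (h a - h (e p.2)), by fun_prop⟩
  have hg : Continuous fun p : I × I => Γ p.2 p.1 := by
    refine hloc.continuous_lift hsep f ?_ ?_ ?_
    · ext p
      exact (hΓ p.2 p.1 p.1.2).1
    · simpa [hΓ0] using he
    · intro t
      exact continuousOn_iff_continuous_domRestrict.1 (hΓc t)
  -- The lifted endpoints vary continuously inside one fibre of a locally injective map, so they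
  -- coincide.
  have hconst := hsep.const_of_comp hloc.isLocallyInjective
    (hg.comp (Continuous.prodMk_right (1 : I))) (fun t t' => by
      change h (Γ t (1 : I)) = h (Γ t' (1 : I))
      rw [(hΓ t _ (1 : I).2).1, (hΓ t' _ (1 : I).2).1]
      simp)
  -- Here the segment is degenerate, and the length bound forces a constant lift.
  have hend : ∀ t, h (e t) = h a → Γ t 1 = e t := by
    intro t ht
    have := (hΓ t 1 (by simp)).2
    rw [ht, sub_self, norm_zero, mul_zero, zero_mul] at this
    exact sub_eq_zero.1 (norm_le_zero_iff.1 this)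
  have h0 := hend 0 (by simp [e])
  have h1 := hend 1 (by simp [e, hab])
  have h01 := hconst 0 1
  simp only [Function.comp_apply] at h01
  have : Γ 0 1 = Γ 1 1 := h01
  rw [h0, h1] at this
  simpa [e] using this

/-! ### Schwarz–Pick estimates -/

open Metric in
/-- A holomorphic function without zeros on a disk has a holomorphic logarithm. -/
theorem DifferentiableOn.exists_exp_eq_on_ball {φ : ℂ → ℂ} {c : ℂ} {r : ℝ}
    (hφ : DifferentiableOn ℂ φ (ball c r)) (h0 : ∀ z ∈ ball c r, φ z ≠ 0) :
    ∃ g : ℂ → ℂ, DifferentiableOn ℂ g (ball c r) ∧ ∀ z ∈ ball c r, Complex.exp (g z) = φ z := by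
  rcases le_or_gt r 0 with hr | hr
  · exact ⟨0, by simp [ball_eq_empty.2 hr], by simp [ball_eq_empty.2 hr]⟩
  have hc : c ∈ ball c r := mem_ball_self hr
  -- `g` is the primitive of `φ'/φ` with `g c = log (φ c)`; then `φ * exp (-g)` is constant, equal
  -- to `1`.
  obtain ⟨g, hgc, hg⟩ := ((hφ.deriv isOpen_ball).div hφ h0).isExactOn_ball.with_val_at c
    (Complex.log (φ c))
  refine ⟨g, fun z hz => (hg z hz).differentiableAt.differentiableWithinAt, fun z hz => ?_⟩
  have hd : ∀ z ∈ ball c r, HasDerivAt (fun z => φ z * Complex.exp (-g z)) 0 z := by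
    intro z hz
    have h1 := (hφ.differentiableAt (isOpen_ball.mem_nhds hz)).hasDerivAt
    have h2 := h1.mul (hg z hz).neg.cexp
    refine h2.congr_deriv ?_
    have := h0 z hz
    simp only [Pi.div_apply]
    field_simp
    ring
  have hconst := isOpen_ball.is_const_of_deriv_eq_zero (convex_ball c r).isPreconnected
    (fun z hz => (hd z hz).differentiableAt.differentiableWithinAt)
    (fun z hz => (hd z hz).deriv) hz hc
  simp only [hgc, Complex.exp_neg, Complex.exp_log (h0 c hc), mul_inv_cancel₀ (h0 c hc)] at hconst
  exact (mul_inv_eq_one₀ (Complex.exp_ne_zero _)).1 hconst |>.symm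

/-- The squares of the two norms differ by `4 Re u Re v`. This puts the Cayley transform centred at
`v` into the unit disk. -/
theorem Complex.norm_sub_lt_norm_add_conj {u v : ℂ} (hu : 0 < u.re) (hv : 0 < v.re) :
    ‖u - v‖ < ‖u + (starRingEnd ℂ) v‖ := by
  refine lt_of_pow_lt_pow_left₀ 2 (norm_nonneg _) ?_
  rw [← Complex.normSq_eq_norm_sq, ← Complex.normSq_eq_norm_sq, Complex.normSq_apply,
    Complex.normSq_apply]
  simp only [Complex.sub_re, Complex.sub_im, Complex.add_re, Complex.add_im, Complex.conj_re,
    Complex.conj_im]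
  nlinarith [mul_pos hu hv]

open Metric in
/-- The Schwarz–Pick lemma at the center of a disk for maps into the right half-plane. -/
theorem Complex.norm_deriv_le_of_re_pos {u : ℂ → ℂ} {c : ℂ} {r : ℝ} (hr : 0 < r)
    (hu : DifferentiableOn ℂ u (ball c r)) (hpos : ∀ z ∈ ball c r, 0 < (u z).re) :
    ‖deriv u c‖ ≤ 2 * (u c).re / r := by
  have hc : c ∈ ball c r := mem_ball_self hr
  have hne : ∀ z ∈ ball c r, u z + (starRingEnd ℂ) (u c) ≠ 0 := fun z hz =>
    norm_pos_iff.1 ((norm_nonneg _).trans_lt (norm_sub_lt_norm_add_conj (hpos z hz) (hpos c hc)))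
  let v : ℂ → ℂ := fun z => (u z - u c) / (u z + (starRingEnd ℂ) (u c))
  have hvc : v c = 0 := by simp [v]
  have hv : DifferentiableOn ℂ v (ball c r) := (hu.sub_const _).div (hu.add_const _) hne
  have hmaps : Set.MapsTo v (ball c r) (closedBall (v c) 1) := by
    intro z hz
    rw [hvc, mem_closedBall_zero_iff, norm_div]
    exact div_le_one_of_le₀ (norm_sub_lt_norm_add_conj (hpos z hz) (hpos c hc)).le (norm_nonneg _)
  have hS := norm_deriv_le_div_of_mapsTo_ball hv hmaps hr
  have hud := (hu.differentiableAt (isOpen_ball.mem_nhds hc)).hasDerivAt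
  have hvd : deriv v c = deriv u c / (2 * (u c).re : ℝ) := by
    have h1 := (hud.sub_const (u c)).div (hud.add_const ((starRingEnd ℂ) (u c))) (hne c hc)
    have h2 := h1.deriv
    have h3 : u c + (starRingEnd ℂ) (u c) = (2 * (u c).re : ℝ) := Complex.add_conj _
    have h4 : ((2 * (u c).re : ℝ) : ℂ) ≠ 0 := h3 ▸ hne c hc
    refine h2.trans ?_
    rw [h3]
    field_simp
    ring
  have hp := hpos c hc
  rw [hvd, norm_div, Complex.norm_real, Real.norm_of_nonneg (by positivity),
    div_le_iff₀ (by positivity)] at hS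
  exact hS.trans_eq (by ring)

open Metric in
/-- The Schwarz–Pick lemma at the center of a disk for maps into a vertical strip. -/
theorem Complex.norm_deriv_le_of_abs_re_lt {g : ℂ → ℂ} {c : ℂ} {r m : ℝ} (hr : 0 < r)
    (hg : DifferentiableOn ℂ g (ball c r)) (hm : ∀ z ∈ ball c r, |(g z).re| < m) :
    ‖deriv g c‖ ≤ 4 * m / (Real.pi * r) := by
  have hc : c ∈ ball c r := mem_ball_self hr
  have hm0 : 0 < m := (abs_nonneg _).trans_lt (hm c hc)
  have hpi := Real.pi_pos
  -- With this scaling, `exp (iκ ·)` maps the strip `|Re| < m` into the right half-plane.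
  set κ : ℝ := Real.pi / (2 * m) with hκ
  have hκ0 : 0 < κ := by positivity
  let u : ℂ → ℂ := fun z => Complex.exp (Complex.I * κ * g z)
  have hu : DifferentiableOn ℂ u (ball c r) := (hg.const_mul _).cexp
  have hpos : ∀ z ∈ ball c r, 0 < (u z).re := by
    intro z hz
    simp only [u, Complex.exp_re]
    refine mul_pos (Real.exp_pos _) (Real.cos_pos_of_mem_Ioo ?_)
    have him : (Complex.I * κ * g z).im = κ * (g z).re := by simp
    have h2 : κ * m = Real.pi / 2 := by rw [hκ]; field_simp
    have h1 := abs_lt.1 (hm z hz)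
    rw [him]
    constructor <;> nlinarith
  have hS := norm_deriv_le_of_re_pos hr hu hpos
  have hgd := (hg.differentiableAt (isOpen_ball.mem_nhds hc)).hasDerivAt
  have hud : deriv u c = u c * (Complex.I * κ * deriv g c) := (hgd.const_mul _).cexp.deriv
  have hu0 : 0 < ‖u c‖ := norm_pos_iff.2 (Complex.exp_ne_zero _)
  rw [hud, norm_mul, norm_mul, norm_mul, Complex.norm_I, one_mul, Complex.norm_real,
    Real.norm_of_nonneg hκ0.le, le_div_iff₀ hr] at hS
  have h1 : ‖u c‖ * (κ * ‖deriv g c‖ * r) ≤ ‖u c‖ * 2 := by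
    have := Complex.re_le_norm (u c)
    nlinarith
  have h2 := le_of_mul_le_mul_left h1 hu0
  rw [le_div_iff₀ (by positivity)]
  have h3 : Real.pi = κ * (2 * m) := by rw [hκ]; field_simp
  rw [h3]
  nlinarith

open Metric in
/-- If `φ` maps a disk into an annulus, its logarithmic derivative at the center is bounded. -/
theorem Complex.norm_deriv_le_of_mem_annulus {φ : ℂ → ℂ} {c : ℂ} {r m : ℝ} (hr : 0 < r)
    (hφ : DifferentiableOn ℂ φ (ball c r))
    (hm : ∀ z ∈ ball c r, Real.exp (-m) < ‖φ z‖ ∧ ‖φ z‖ < Real.exp m) :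
    ‖deriv φ c‖ ≤ 4 * m / (Real.pi * r) * ‖φ c‖ := by
  have hc : c ∈ ball c r := mem_ball_self hr
  obtain ⟨g, hg, hexp⟩ := hφ.exists_exp_eq_on_ball fun z hz =>
    norm_pos_iff.1 ((Real.exp_pos _).trans (hm z hz).1)
  have hre : ∀ z ∈ ball c r, |(g z).re| < m := by
    intro z hz
    have := hm z hz
    rw [← hexp z hz, Complex.norm_exp, Real.exp_lt_exp, Real.exp_lt_exp] at this
    exact abs_lt.2 this
  have hS := norm_deriv_le_of_abs_re_lt hr hg hre
  have hgd := (hg.differentiableAt (isOpen_ball.mem_nhds hc)).hasDerivAt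
  have hd : deriv φ c = φ c * deriv g c := by
    rw [← hexp c hc, ← hgd.cexp.deriv]
    exact Filter.EventuallyEq.deriv_eq
      (Filter.eventuallyEq_of_mem (isOpen_ball.mem_nhds hc) fun z hz => (hexp z hz).symm)
  rw [hd, norm_mul, mul_comm]
  gcongr

/-! ### The Ahlfors–Becker extension and univalence on the half-plane -/

/-- The real-linear map `h ↦ a * h + b * conj h`. -/
noncomputable def linearConjCLM (a b : ℂ) : ℂ →L[ℝ] ℂ :=
  a • ContinuousLinearMap.id ℝ ℂ + b • Complex.conjCLE.toContinuousLinearMap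

theorem linearConjCLM_apply (a b h : ℂ) :
    linearConjCLM a b h = a * h + b * (starRingEnd ℂ) h := rfl

theorem le_norm_linearConjCLM_apply (a b h : ℂ) :
    (‖a‖ - ‖b‖) * ‖h‖ ≤ ‖linearConjCLM a b h‖ := by
  rw [linearConjCLM_apply]
  have h1 := norm_sub_le_norm_add (a * h) (b * (starRingEnd ℂ) h)
  rw [norm_mul, norm_mul, Complex.norm_conj] at h1
  linarith

/-- A bounded-below endomorphism of a finite-dimensional space is invertible, with a bound on
the norm of the inverse. -/
theorem ContinuousLinearMap.exists_equiv_of_le_norm {E : Type*} [NormedAddCommGroup E]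
    [NormedSpace ℝ E] [FiniteDimensional ℝ E] (T : E →L[ℝ] E) {c : ℝ} (hc : 0 < c)
    (hT : ∀ v, c * ‖v‖ ≤ ‖T v‖) :
    ∃ e : E ≃L[ℝ] E, (e : E →L[ℝ] E) = T ∧ ‖(e.symm : E →L[ℝ] E)‖ ≤ c⁻¹ := by
  have hinj : Function.Injective (T : E →ₗ[ℝ] E) := by
    refine (injective_iff_map_eq_zero _).2 fun v hv => ?_
    have h1 := hT v
    have h2 : T v = 0 := hv
    rw [h2, norm_zero] at h1
    exact norm_le_zero_iff.1 (nonpos_of_mul_nonpos_right h1 hc)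
  let e := (LinearEquiv.ofInjectiveEndo (T : E →ₗ[ℝ] E) hinj).toContinuousLinearEquiv
  have he : ∀ v, e v = T v := fun v => rfl
  refine ⟨e, ContinuousLinearMap.ext he, ?_⟩
  refine ContinuousLinearMap.opNorm_le_bound _ (by positivity) fun v => ?_
  have h1 := hT (e.symm v)
  rw [← he, e.apply_symm_apply] at h1
  rw [← div_eq_inv_mul, le_div_iff₀' hc]
  exact h1

/-- The folding `x + iy ↦ |x| + iy` of the plane onto the closed right half-plane. -/
noncomputable def foldRe (w : ℂ) : ℂ := ⟨|w.re|, w.im⟩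

theorem foldRe_of_nonneg {w : ℂ} (hw : 0 ≤ w.re) : foldRe w = w :=
  Complex.ext (abs_of_nonneg hw) rfl

theorem foldRe_of_nonpos {w : ℂ} (hw : w.re ≤ 0) : foldRe w = -(starRingEnd ℂ) w :=
  Complex.ext (by simp [foldRe, abs_of_nonpos hw]) (by simp [foldRe])

theorem continuous_foldRe : Continuous foldRe := by
  have : foldRe = fun w : ℂ => ((|w.re| : ℝ) : ℂ) + (w.im : ℝ) * Complex.I := by
    ext w
    exact Complex.mk_eq_add_mul_I _ _
  rw [this]
  fun_prop

/-- The Ahlfors–Becker extension across the imaginary axis of a function on the right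
half-plane. -/
noncomputable def halfPlaneExtension (F : ℂ → ℂ) (w : ℂ) : ℂ :=
  F (foldRe w) - 2 * (max (-w.re) 0 : ℝ) * deriv F (foldRe w)

open Filter Topology

theorem isOpen_lt_re (a : ℝ) : IsOpen {z : ℂ | a < z.re} :=
  isOpen_lt continuous_const Complex.continuous_re

theorem hasFDerivAt_halfPlaneExtension_left {F : ℂ → ℂ} {w : ℂ}
    (hF : DifferentiableAt ℂ F (-(starRingEnd ℂ) w))
    (hF' : DifferentiableAt ℂ (deriv F) (-(starRingEnd ℂ) w)) :
    HasFDerivAt (fun w : ℂ => F (-(starRingEnd ℂ) w) +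
        (w + (starRingEnd ℂ) w) * deriv F (-(starRingEnd ℂ) w))
      (linearConjCLM (deriv F (-(starRingEnd ℂ) w))
        (2 * (-w.re : ℝ) * deriv (deriv F) (-(starRingEnd ℂ) w))) w := by
  have hc : HasFDerivAt (fun w : ℂ => (starRingEnd ℂ) w)
      (Complex.conjCLE.toContinuousLinearMap) w := Complex.conjCLE.hasFDerivAt
  have h1 := (hF.hasDerivAt.hasFDerivAt.restrictScalars ℝ).comp w hc.neg
  have h2 := (hF'.hasDerivAt.hasFDerivAt.restrictScalars ℝ).comp w hc.neg
  have h3 := h1.add (((hasFDerivAt_id w).add hc).mul h2)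
  refine h3.congr_fderiv ?_
  ext1 h
  have hw : w + (starRingEnd ℂ) w = 2 * (w.re : ℝ) := by simpa using Complex.add_conj w
  simp [linearConjCLM_apply, hw]
  ring

/-- The factor `max (-w.re) 0` vanishes on the imaginary axis, so the derivatives from the two sides
agree there and a single continuous formula covers the plane; continuity makes the derivative
strict. -/
theorem hasStrictFDerivAt_halfPlaneExtension {F : ℂ → ℂ} {ε : ℝ} (hε : 0 < ε)
    (hF : DifferentiableOn ℂ F {z | -ε < z.re}) (w : ℂ) :
    HasStrictFDerivAt (halfPlaneExtension F) (linearConjCLM (deriv F (foldRe w))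
      (2 * (max (-w.re) 0 : ℝ) * deriv (deriv F) (foldRe w))) w := by
  have hopen := isOpen_lt_re (-ε)
  have hF' := hF.deriv hopen
  have hF'' := hF'.deriv hopen
  have hfold : ∀ w, foldRe w ∈ {z : ℂ | -ε < z.re} := fun w =>
    lt_of_lt_of_le (by linarith) (abs_nonneg w.re)
  have d0 : ∀ w, DifferentiableAt ℂ F (foldRe w) := fun w =>
    hF.differentiableAt (hopen.mem_nhds (hfold w))
  have d1 : ∀ w, DifferentiableAt ℂ (deriv F) (foldRe w) := fun w =>
    hF'.differentiableAt (hopen.mem_nhds (hfold w))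
  refine hasStrictFDerivAt_of_hasFDerivAt_of_continuousAt
    (f' := fun w => linearConjCLM (deriv F (foldRe w))
      (2 * (max (-w.re) 0 : ℝ) * deriv (deriv F) (foldRe w))) (Eventually.of_forall fun w => ?_) ?_
  · have hright : 0 ≤ w.re → HasFDerivWithinAt (halfPlaneExtension F)
        (linearConjCLM (deriv F (foldRe w))
          (2 * (max (-w.re) 0 : ℝ) * deriv (deriv F) (foldRe w))) {z | 0 ≤ z.re} w := by
      intro hw
      have h1 := ((d0 w).hasDerivAt.hasFDerivAt.restrictScalars ℝ).hasFDerivWithinAt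
        (s := {z : ℂ | 0 ≤ z.re})
      rw [foldRe_of_nonneg hw] at h1 ⊢
      refine (h1.congr_fderiv ?_).congr (fun z hz => ?_) ?_
      · ext1 h
        simp [linearConjCLM_apply, hw, mul_comm]
      · have hz' : 0 ≤ z.re := hz
        simp [halfPlaneExtension, foldRe_of_nonneg hz', hz']
      · simp [halfPlaneExtension, foldRe_of_nonneg hw, hw]
    have hleft : w.re ≤ 0 → HasFDerivWithinAt (halfPlaneExtension F)
        (linearConjCLM (deriv F (foldRe w))
          (2 * (max (-w.re) 0 : ℝ) * deriv (deriv F) (foldRe w))) {z | z.re ≤ 0} w := by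
      intro hw
      have e0 := d0 w
      have e1 := d1 w
      rw [foldRe_of_nonpos hw] at e0 e1 ⊢
      rw [max_eq_left (by linarith)]
      have heq : ∀ z : ℂ, z.re ≤ 0 → halfPlaneExtension F z = F (-(starRingEnd ℂ) z) +
          (z + (starRingEnd ℂ) z) * deriv F (-(starRingEnd ℂ) z) := by
        intro z hz
        have hzz : z + (starRingEnd ℂ) z = 2 * (z.re : ℝ) := by simpa using Complex.add_conj z
        rw [halfPlaneExtension, foldRe_of_nonpos hz, max_eq_left (by linarith), hzz]
        push_cast
        ring
      exact (hasFDerivAt_halfPlaneExtension_left e0 e1).hasFDerivWithinAt.congr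
        (fun z hz => heq z hz) (heq w hw)
    rcases lt_trichotomy w.re 0 with hw | hw | hw
    · exact (hleft hw.le).hasFDerivAt (mem_of_superset
        ((isOpen_lt Complex.continuous_re continuous_const).mem_nhds hw) fun z (hz : z.re < 0) => hz.le)
    · have := (hright hw.ge).union (hleft hw.le)
      refine this.hasFDerivAt (Filter.univ_mem' fun z => le_total 0 z.re)
    · exact (hright hw.le).hasFDerivAt (mem_of_superset
        ((isOpen_lt_re 0).mem_nhds hw) fun z (hz : 0 < z.re) => hz.le)
  · have c1 : Continuous fun w => deriv F (foldRe w) :=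
      hF'.continuousOn.comp_continuous continuous_foldRe hfold
    have c2 : Continuous fun w => deriv (deriv F) (foldRe w) :=
      hF''.continuousOn.comp_continuous continuous_foldRe hfold
    have c3 : Continuous fun w : ℂ => ((max (-w.re) 0 : ℝ) : ℂ) := by fun_prop
    exact ((c1.smul continuous_const).add
      (((continuous_const.mul c3).mul c2).smul continuous_const)).continuousAt

/-- A Becker-type univalence criterion on the right half-plane. -/
theorem injOn_of_norm_deriv_deriv_le {F : ℂ → ℂ} {ε c k : ℝ} (hε : 0 < ε) (hc : 0 < c) (hk : k < 1)
    (hF : DifferentiableOn ℂ F {z | -ε < z.re}) (hF1 : ∀ z : ℂ, 0 ≤ z.re → c ≤ ‖deriv F z‖)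
    (hF2 : ∀ z : ℂ, 0 ≤ z.re → 2 * z.re * ‖deriv (deriv F) z‖ ≤ k * ‖deriv F z‖) :
    Set.InjOn F {z | 0 ≤ z.re} := by
  have hck : 0 < (1 - k) * c := mul_pos (by linarith) hc
  have hex : ∀ w, ∃ e : ℂ ≃L[ℝ] ℂ, HasStrictFDerivAt (halfPlaneExtension F) (e : ℂ →L[ℝ] ℂ) w ∧
      ‖(e.symm : ℂ →L[ℝ] ℂ)‖ ≤ ((1 - k) * c)⁻¹ := by
    intro w
    have hre : 0 ≤ (foldRe w).re := abs_nonneg w.re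
    have hmax : max (-w.re) 0 ≤ (foldRe w).re := max_le (neg_le_abs _) (abs_nonneg _)
    have h1 := hF1 _ hre
    have h2 := hF2 _ hre
    have h3 : ‖(2 * (max (-w.re) 0 : ℝ) * deriv (deriv F) (foldRe w) : ℂ)‖ ≤
        k * ‖deriv F (foldRe w)‖ := by
      refine le_trans ?_ h2
      rw [norm_mul, norm_mul, Complex.norm_real, Real.norm_of_nonneg (le_max_right _ _),
        Complex.norm_ofNat]
      gcongr
    obtain ⟨e, he, hen⟩ := ContinuousLinearMap.exists_equiv_of_le_norm (linearConjCLM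
      (deriv F (foldRe w)) (2 * (max (-w.re) 0 : ℝ) * deriv (deriv F) (foldRe w))) hck fun v =>
        le_trans (mul_le_mul_of_nonneg_right (by nlinarith) (norm_nonneg v))
          (le_norm_linearConjCLM_apply _ _ v)
    exact ⟨e, he ▸ hasStrictFDerivAt_halfPlaneExtension hε hF w, hen⟩
  choose e he hen using hex
  have hinj := injective_of_hasStrictFDerivAt_equiv he
    (C := (((1 - k) * c)⁻¹ + 1).toNNReal) fun x => by
      rw [← NNReal.coe_lt_coe, Real.coe_toNNReal _ (by linarith [inv_pos.2 hck])]
      exact lt_of_le_of_lt (hen x) (lt_add_one _)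
  intro a ha b hb hab
  have heq : ∀ z : ℂ, 0 ≤ z.re → halfPlaneExtension F z = F z := fun z hz => by
    simp [halfPlaneExtension, foldRe_of_nonneg hz, hz]
  exact hinj (by rw [heq a ha, heq b hb, hab])

/-- A holomorphic map of the right half-plane whose derivative stays in a thin annulus is
injective. -/
theorem injOn_of_deriv_mem_annulus {Φ : ℂ → ℂ} {m : ℝ} (hm : m < Real.pi / 8)
    (hΦ : DifferentiableOn ℂ Φ {z | 0 < z.re})
    (hb : ∀ z : ℂ, 0 < z.re → Real.exp (-m) < ‖deriv Φ z‖ ∧ ‖deriv Φ z‖ < Real.exp m) :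
    Set.InjOn Φ {z | 0 < z.re} := by
  intro a ha b hb' hab
  have hm0 : 0 < m := by
    have := hb a ha
    have := Real.exp_lt_exp.1 (this.1.trans this.2)
    linarith
  have hpi := Real.pi_pos
  have ha0 : 0 < a.re := ha
  have hb0 : 0 < b.re := hb'
  -- Translating by `ε` makes the function holomorphic across the imaginary axis, while `a - ε` and
  -- `b - ε` stay in the half-plane.
  obtain ⟨ε, hε, hεab⟩ := exists_between (lt_min ha0 hb0)
  obtain ⟨hεa, hεb⟩ := lt_min_iff.1 hεab
  let F : ℂ → ℂ := fun z => Φ (z + ε)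
  have hF1 : ∀ z, deriv F z = deriv Φ (z + ε) := fun z => deriv_comp_add_const Φ (ε : ℂ) z
  have hF2 : ∀ z, deriv (deriv F) z = deriv (deriv Φ) (z + ε) := fun z => by
    rw [funext hF1]
    exact deriv_comp_add_const (deriv Φ) (ε : ℂ) z
  have hFd : DifferentiableOn ℂ F {z | -ε < z.re} := by
    refine hΦ.comp (by fun_prop) fun z hz => ?_
    have : -ε < z.re := hz
    simp only [Set.mem_ofPred_eq, Complex.add_re, Complex.ofReal_re]
    linarith
  have key := injOn_of_norm_deriv_deriv_le (k := 8 * m / Real.pi) hε (Real.exp_pos (-m))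
    (by rw [div_lt_one hpi]; linarith) hFd
    (fun z hz => by
      rw [hF1]
      exact (hb _ (by simpa using by linarith)).1.le)
    (fun z hz => by
      rw [hF1, hF2]
      have hsub : Metric.ball (z + ε) (z.re + ε) ⊆ {w : ℂ | 0 < w.re} := by
        intro w hw
        have h1 := (Complex.abs_re_le_norm (w - (z + ε))).trans_lt (mem_ball_iff_norm.1 hw)
        have h2 := (abs_lt.1 h1).1
        simp only [Complex.sub_re, Complex.add_re, Complex.ofReal_re] at h2
        simp only [Set.mem_ofPred_eq]
        linarith
      have h3 := Complex.norm_deriv_le_of_mem_annulus (r := z.re + ε) (by linarith)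
        ((hΦ.deriv (isOpen_lt_re 0)).mono hsub) fun w hw => hb w (hsub hw)
      have h4 : z.re / (z.re + ε) ≤ 1 := div_le_one_of_le₀ (by linarith) (by linarith)
      have h5 : 0 ≤ 8 * m / Real.pi * ‖deriv Φ (z + ε)‖ := by positivity
      have h6 : 0 < z.re + ε := by linarith
      calc 2 * z.re * ‖deriv (deriv Φ) (z + ε)‖
          ≤ 2 * z.re * (4 * m / (Real.pi * (z.re + ε)) * ‖deriv Φ (z + ε)‖) := by gcongr
        _ = z.re / (z.re + ε) * (8 * m / Real.pi * ‖deriv Φ (z + ε)‖) := by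
            field_simp
            ring
        _ ≤ 8 * m / Real.pi * ‖deriv Φ (z + ε)‖ := mul_le_of_le_one_left h5 h4)
  have := @key (a - ε) (by simpa using hεa.le) (b - ε) (by simpa using hεb.le)
    (by simpa [F] using hab)
  simpa using this

/-! ### Transfer to the disk -/

open Filter Topology in
/-- If `z f'(z) / f(z)` stays strictly inside an annulus near `0` whose outer radius is less than
`2`, then `f` has a simple zero at `0`. -/
theorem AnalyticAt.simple_zero_of_norm_logDeriv_mem {f : ℂ → ℂ} {m : ℝ} (hf : AnalyticAt ℂ f 0)
    (hm : Real.exp m < 2) (hb : ∀ᶠ z in 𝓝[≠] (0 : ℂ),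
      Real.exp (-m) < ‖z * deriv f z / f z‖ ∧ ‖z * deriv f z / f z‖ < Real.exp m) :
    f 0 = 0 ∧ deriv f 0 ≠ 0 := by
  have hnz : ¬ ∀ᶠ z in 𝓝 (0 : ℂ), f z = 0 := by
    intro h
    obtain ⟨z, hz, hz'⟩ := ((h.filter_mono nhdsWithin_le_nhds).and hb).exists
    rw [hz, div_zero, norm_zero] at hz'
    exact (Real.exp_pos _).not_gt hz'.1
  obtain ⟨n, g, hg, hg0, hfg⟩ := hf.exists_eventuallyEq_pow_smul_nonzero_iff.2 hnz
  replace hfg : f =ᶠ[𝓝 0] fun z => z ^ n * g z :=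
    hfg.mono fun z hz => by simpa using hz
  have hev : ∀ᶠ z in 𝓝[≠] (0 : ℂ), z * deriv f z / f z = n + z * deriv g z / g z := by
    have e1 : ∀ᶠ z in 𝓝[≠] (0 : ℂ), f =ᶠ[𝓝 z] fun z => z ^ n * g z :=
      hfg.eventually_nhds.filter_mono nhdsWithin_le_nhds
    have e2 := hg.eventually_analyticAt.filter_mono (nhdsWithin_le_nhds (s := {0}ᶜ))
    have e3 := (hg.continuousAt.eventually_ne hg0).filter_mono (nhdsWithin_le_nhds (s := {0}ᶜ))
    filter_upwards [e1, e2, e3, self_mem_nhdsWithin] with z h1 h2 h3 h4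
    have hz : z ≠ 0 := h4
    rw [h1.deriv_eq, h1.eq_of_nhds, deriv_fun_mul (by fun_prop) h2.differentiableAt, deriv_pow_field]
    rcases n with _ | n
    · simp
    · simp only [Nat.add_sub_cancel]
      field_simp
      ring
  have hlim : Tendsto (fun z => ‖z * deriv f z / f z‖) (𝓝[≠] (0 : ℂ)) (𝓝 n) := by
    have hc : ContinuousAt (fun z => ‖(n : ℂ) + z * deriv g z / g z‖) 0 :=
      (continuousAt_const.add ((continuousAt_id.mul hg.deriv.continuousAt).div
        hg.continuousAt hg0)).norm
    have := hc.tendsto.mono_left (nhdsWithin_le_nhds (s := {0}ᶜ))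
    simp only [zero_mul, zero_div, add_zero, Complex.norm_natCast] at this
    exact this.congr' (hev.mono fun z hz => congrArg norm hz.symm)
  have h1 : Real.exp (-m) ≤ n := ge_of_tendsto hlim (hb.mono fun z hz => hz.1.le)
  have h2 : (n : ℝ) ≤ Real.exp m := le_of_tendsto hlim (hb.mono fun z hz => hz.2.le)
  -- The quotient tends to the order `n` of vanishing, so `0 < n < 2`.
  have h3 : 0 < n := by exact_mod_cast (Real.exp_pos _).trans_le h1
  have h4 : n < 2 := by exact_mod_cast h2.trans_lt hm
  obtain rfl : n = 1 := by omega
  refine ⟨by simpa using hfg.eq_of_nhds, ?_⟩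
  rw [hfg.deriv_eq, deriv_fun_mul (by fun_prop) hg.differentiableAt]
  simpa using hg0

theorem annulusConditionImpliesUnivalence_of_lt {m : ℝ} (hm : m < Real.pi / 8) :
    AnnulusConditionImpliesUnivalence m := by
  intro f hf hb
  have hm2 : Real.exp m < 2 := by
    rw [← Real.lt_log_iff_exp_lt two_pos]
    have := Real.pi_lt_d2
    have := Real.log_two_gt_d9
    linarith
  have hfa : ∀ z ∈ Metric.ball (0 : ℂ) 1, AnalyticAt ℂ f z := fun z hz =>
    hf.analyticAt (Metric.isOpen_ball.mem_nhds hz)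
  obtain ⟨hf0, hf1⟩ := (hfa 0 (by simp)).simple_zero_of_norm_logDeriv_mem hm2 (by
    filter_upwards [mem_nhdsWithin_of_mem_nhds (Metric.ball_mem_nhds (0 : ℂ) one_pos),
      self_mem_nhdsWithin] with z hz hz0
    exact hb z (norm_pos_iff.2 hz0) (mem_ball_zero_iff.1 hz))
  have hfne : ∀ z : ℂ, 0 < ‖z‖ → ‖z‖ < 1 → f z ≠ 0 := by
    intro z hz0 hz1 h
    have := (hb z hz0 hz1).1
    rw [h, div_zero, norm_zero] at this
    exact (Real.exp_pos _).not_gt this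
  have hqf : ∀ z, z * dslope f 0 z = f z := fun z => by
    simpa [hf0] using sub_smul_dslope f 0 z
  obtain ⟨l, hl, hexp⟩ := ((Complex.differentiableOn_dslope
    (Metric.ball_mem_nhds (0 : ℂ) one_pos)).2 hf).exists_exp_eq_on_ball fun z hz => by
      rcases eq_or_ne z 0 with rfl | hz0
      · rwa [dslope_same]
      · have := hfne z (norm_pos_iff.2 hz0) (mem_ball_zero_iff.1 hz)
        rw [← hqf] at this
        exact right_ne_zero_of_mul this
  have hball : ∀ w : ℂ, 0 < w.re → Complex.exp (-w) ∈ Metric.ball (0 : ℂ) 1 := fun w hw => by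
    simpa [Complex.norm_exp] using hw
  -- As `exp (l z) = f(z)/z`, this is a branch of `-log f(exp (-w))`.
  let Φ : ℂ → ℂ := fun w => w - l (Complex.exp (-w))
  have hΦd : DifferentiableOn ℂ Φ {z | 0 < z.re} :=
    differentiableOn_id.sub (hl.comp (by fun_prop) hball)
  have hΦe : ∀ w : ℂ, 0 < w.re → Complex.exp (-Φ w) = f (Complex.exp (-w)) := fun w hw => by
    rw [← hqf, ← hexp _ (hball w hw), ← Complex.exp_add]
    congr 1
    simp only [Φ]
    ring
  have hΦ' : ∀ w : ℂ, 0 < w.re → deriv Φ w =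
      Complex.exp (-w) * deriv f (Complex.exp (-w)) / f (Complex.exp (-w)) := by
    intro w hw
    have hnhds := (isOpen_lt_re 0).mem_nhds hw
    have h1 := (hΦd.differentiableAt hnhds).hasDerivAt.neg.cexp
    have h2 := ((hfa _ (hball w hw)).differentiableAt.hasDerivAt).comp w (hasDerivAt_neg w).cexp
    have h3 := h1.unique (h2.congr_of_eventuallyEq
      (Filter.eventuallyEq_of_mem hnhds fun z hz => hΦe z hz))
    have h4 := hΦe w hw
    simp only [Pi.neg_apply] at h3
    rw [h4] at h3
    have h5 : f (Complex.exp (-w)) ≠ 0 := h4 ▸ Complex.exp_ne_zero _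
    rw [eq_div_iff h5]
    linear_combination -h3
  have hinj := injOn_of_deriv_mem_annulus hm hΦd fun w hw => by
    rw [hΦ' w hw]
    exact hb _ (norm_pos_iff.2 (Complex.exp_ne_zero _)) (mem_ball_zero_iff.1 (hball w hw))
  intro a ha b hb' hab
  have hzero : ∀ z ∈ Metric.ball (0 : ℂ) 1, f z = 0 → z = 0 := fun z hz h => by
    by_contra hz0
    exact hfne z (norm_pos_iff.2 hz0) (mem_ball_zero_iff.1 hz) h
  rcases eq_or_ne a 0 with rfl | ha0
  · exact (hzero b hb' (by rw [← hab, hf0])).symm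
  rcases eq_or_ne b 0 with rfl | hb0
  · exact hzero a ha (by rw [hab, hf0])
  have hlog : ∀ z ∈ Metric.ball (0 : ℂ) 1, z ≠ 0 → ∃ w : ℂ, 0 < w.re ∧ Complex.exp (-w) = z := by
    intro z hz hz0
    refine ⟨-Complex.log z, ?_, by rw [neg_neg, Complex.exp_log hz0]⟩
    rw [Complex.neg_re, Complex.log_re]
    have := Real.log_neg (norm_pos_iff.2 hz0) (mem_ball_zero_iff.1 hz)
    linarith
  obtain ⟨u, hu, rfl⟩ := hlog a ha ha0
  obtain ⟨v, hv, rfl⟩ := hlog b hb' hb0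
  rw [← hΦe u hu, ← hΦe v hv, Complex.exp_eq_exp_iff_exists_int] at hab
  obtain ⟨n, hn⟩ := hab
  -- Moving `v` by a period absorbs the ambiguity `2πin` of the logarithm without changing `exp
  -- (-v)`.
  have hper : Complex.exp (-(v - n * (2 * Real.pi * Complex.I))) = Complex.exp (-v) :=
    Complex.exp_eq_exp_iff_exists_int.2 ⟨n, by ring⟩
  have hre : 0 < (v - n * (2 * Real.pi * Complex.I)).re := by simpa using hv
  have : u = v - n * (2 * Real.pi * Complex.I) := hinj hu hre (by
    simp only [Φ] at hn ⊢
    rw [hper]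
    linear_combination -hn)
  rw [this, hper]

theorem lemma4p1 :
    (∃ m : ℝ, 0 < m ∧ AnnulusConditionImpliesUnivalence m) ∧
      AnnulusConditionImpliesUnivalence (Real.pi / 12) := by
  have h : AnnulusConditionImpliesUnivalence (Real.pi / 12) :=
    annulusConditionImpliesUnivalence_of_lt (by linarith [Real.pi_pos])
  exact ⟨⟨Real.pi / 12, by positivity, h⟩, h⟩
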